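/- **Criterion II.** Let $F$ be a finite Borel measure on $\mathbb{R}$ with moment generating function $M(s)=\int e^{sx}\,dF(x)\in[0,\infty]$ $(s\in\mathbb{R})$, and define the critical exponents $q^*$ and $r^*$ by $$-q^*=\inf\{s\in\mathbb{R}: M(s)<\infty\},\qquad r^*=\sup\{s\in\mathbb{R}: M(s)<\infty\}.$$ Assume that $q^*,r^*\in(0,\infty)$. Let $R_0$ denote the class of slowly varying functions at infinity: functions $l$ that are positive and measurable on some half-line $[X,\infty)$ and satisfy $l(cx)/l(x)\to1$ as $x\to\infty$ for every $c>0$. Write $f\sim g$ if $f/g\to1$ in the indicated limit. (i) If $\log M(-q^*+s)\sim s^{-\rho}\,l(1/s)$ as $s\to0+$ for some $\rho>0$ and some $l\in R_0$, then $$\log F\big((-\infty,-x]\big)\sim -q^*x\qquad\text{as }x\to\infty.$$ (ii) If $\log M(r^*-s)\sim s^{-\rho}\,l(1/s)$ as $s\to0+$ for some $\rho>0$ and some $l\in R_0$, then $$\log F\big((x,\infty)\big)\sim -r^*x\qquad\text{as }x\to\infty.$$ -/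

import Mathlib

open scoped Topology Asymptotics

/-- The class `R₀`: `l` is slowly varying at `+∞` if on some half-line `[X, ∞)` it is positive and
measurable, and `l (c * x) / l x → 1` as `x → ∞` for every `c > 0`. Values of `l` below `X` play
no role. -/
def IsSlowlyVarying (l : ℝ → ℝ) : Prop :=
  (∃ X : ℝ, (∀ x, X ≤ x → 0 < l x) ∧ Measurable (fun x : Set.Ici X => l x)) ∧
    ∀ c : ℝ, 0 < c → Filter.Tendsto (fun x => l (c * x) / l x) Filter.atTop (𝓝 1)

/-!
The point is that the mass of the exponentially tilted measure `exp (lam * x) dF` concentrates as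
`lam` approaches the critical exponent. It suffices to treat the upper exponent `r`, since
reflection in the origin exchanges the two tails. Write `K s = log M (r - s)`.

Chernoff's bound at `lam < r` gives `log F (x, ∞) ≤ -lam * x + O(1)`, hence the upper half of the
asymptotics; this uses only finiteness of `M` below `r`.

For the lower half, regular variation gives `K (c * s) / K s → c ^ (-ρ)` for every `c > 0`
(`IsSlowlyVarying.tendsto_ratio`). Since `u ↦ u ^ (-ρ)` has slope `-ρ` at `1`, Chernoff's bounds for
the tilt by `r - s`, with the additional exponents `± δ * s` for a small fixed `δ`, show that this
tilt puts at least half of its mass on `(a * K s / s, b * K s / s]` as soon as `a < ρ < b` and `s`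
is small (`half_mgf_le_exp_mul_tail`, `exists_rpow_neg_lt`); here `K s → ∞` is needed
(`tendsto_mgf_atTop_of_ratio`). On that interval the density is at most `exp (r * b * K s / s)`,
so `F (a * K s / s, ∞) ≥ exp (-r * b * K s / s)`. As `K s / s` is continuous and tends to infinity,
every large `x` equals `a * K s / s` for some small `s`, and `b / a` can be taken arbitrarily close
to `1` (`eventually_exp_le_tail`).
-/

open MeasureTheory ProbabilityTheory Filter Set

/-! ### Regular variation at zero -/

/-- The ratio limit of a regularly varying function: along `s → 0+`, a function equivalent to
`s ^ (-ρ) * l (1 / s)` scales like `s ^ (-ρ)`. -/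
theorem IsSlowlyVarying.tendsto_ratio {l K : ℝ → ℝ} {ρ : ℝ} (hl : IsSlowlyVarying l)
    (hK : K ~[𝓝[>] 0] fun s => s ^ (-ρ) * l (1 / s)) {c : ℝ} (hc : 0 < c) :
    Tendsto (fun s => K (c * s) / K s) (𝓝[>] 0) (𝓝 (c ^ (-ρ))) := by
  have hscale : Tendsto (fun s : ℝ => c * s) (𝓝[>] 0) (𝓝[>] 0) := by
    refine tendsto_nhdsWithin_iff.2 ⟨?_, ?_⟩
    · have : Tendsto (fun s : ℝ => c * s) (𝓝 0) (𝓝 (c * 0)) := by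
        exact (continuous_const_mul c).tendsto 0
      rw [mul_zero] at this
      exact this.mono_left nhdsWithin_le_nhds
    · filter_upwards [self_mem_nhdsWithin] with s hs using mul_pos hc hs
  have hdiv := (hK.comp_tendsto hscale).div hK
  refine (hdiv.tendsto_nhds_iff (c := c ^ (-ρ))).2 ?_
  have hlim : Tendsto (fun s : ℝ => c ^ (-ρ) * (l (c⁻¹ * s⁻¹) / l s⁻¹)) (𝓝[>] 0)
      (𝓝 (c ^ (-ρ) * 1)) :=
    ((hl.2 c⁻¹ (inv_pos.2 hc)).comp tendsto_inv_nhdsGT_zero).const_mul _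
  rw [mul_one] at hlim
  refine hlim.congr' ?_
  filter_upwards [self_mem_nhdsWithin] with s hs
  have hs : 0 < s := hs
  have hsp : s ^ (-ρ) ≠ 0 := (Real.rpow_pos_of_pos hs _).ne'
  simp only [Function.comp_apply, Pi.div_apply, one_div, mul_inv]
  rw [Real.mul_rpow hc.le hs.le, mul_assoc, mul_div_assoc, mul_div_mul_left _ _ hsp]

theorem IsSlowlyVarying.eventually_pos {l K : ℝ → ℝ} {ρ : ℝ} (hl : IsSlowlyVarying l)
    (hK : K ~[𝓝[>] 0] fun s => s ^ (-ρ) * l (1 / s)) : ∀ᶠ s in 𝓝[>] 0, 0 < K s := by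
  obtain ⟨X, hX, -⟩ := hl.1
  obtain ⟨u, hu, hKu⟩ := hK.exists_eq_mul
  filter_upwards [hKu, hu.eventually (lt_mem_nhds one_pos), self_mem_nhdsWithin,
    tendsto_inv_nhdsGT_zero.eventually (eventually_ge_atTop X)] with s h1 h2 h3 h4
  rw [h1]
  refine mul_pos h2 (mul_pos (Real.rpow_pos_of_pos h3 _) (hX _ ?_))
  simpa using h4

/-- The slope of `u ↦ u ^ (-ρ)` at `1` is `-ρ`, so it separates any `a < ρ < b`. -/
theorem exists_rpow_neg_lt {ρ a b : ℝ} (ha : a < ρ) (hb : ρ < b) :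
    ∃ δ : ℝ, 0 < δ ∧ δ < 1 ∧ (1 - δ) ^ (-ρ) < 1 + b * δ ∧ (1 + δ) ^ (-ρ) < 1 - a * δ := by
  have h1 : HasDerivAt (fun t : ℝ => (1 + t) ^ (-ρ)) (-ρ) 0 := by
    have := ((hasDerivAt_id (0 : ℝ)).const_add 1).rpow_const (p := -ρ) (by simp)
    simpa using this
  have h2 : HasDerivAt (fun t : ℝ => (1 - t) ^ (-ρ)) ρ 0 := by
    have := ((hasDerivAt_id (0 : ℝ)).const_sub 1).rpow_const (p := -ρ) (by simp)
    simpa using this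
  have e1 := h1.tendsto_slope_zero_right.eventually (gt_mem_nhds (neg_lt_neg ha))
  have e2 := h2.tendsto_slope_zero_right.eventually (gt_mem_nhds hb)
  obtain ⟨δ, h1, h2, h3⟩ := (e1.and (e2.and (Ioo_mem_nhdsGT one_pos))).exists
  refine ⟨δ, h3.1, h3.2, ?_, ?_⟩
  · simp only [zero_add, sub_zero, Real.one_rpow, smul_eq_mul] at h2
    rw [inv_mul_lt_iff₀ h3.1] at h2
    linarith
  · simp only [zero_add, add_zero, Real.one_rpow, smul_eq_mul] at h1
    rw [inv_mul_lt_iff₀ h3.1] at h1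
    linarith

/-! ### Moment generating functions near the critical exponent -/

section MGF

variable {F : Measure ℝ}

/-- Two-sided Chernoff bound for the exponentially tilted measure: if the tilts by `lam + t` and
`lam - u` show that at most a quarter of the mass of `exp (lam * x) dF` lies above `β`, and at most
a quarter below `α`, then the remaining half bounds the tail of `F` beyond `α` from below. -/
theorem half_mgf_le_exp_mul_tail [IsFiniteMeasure F] {lam t u α β : ℝ} (hlam : 0 ≤ lam)
    (ht : 0 ≤ t) (hu : 0 ≤ u)
    (hint : Integrable (fun x => Real.exp (lam * x)) F)
    (hintt : Integrable (fun x => Real.exp ((lam + t) * x)) F)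
    (hintu : Integrable (fun x => Real.exp ((lam - u) * x)) F)
    (hβ : Real.exp (-(t * β)) * mgf id F (lam + t) ≤ mgf id F lam / 4)
    (hα : Real.exp (u * α) * mgf id F (lam - u) ≤ mgf id F lam / 4) :
    mgf id F lam / 2 ≤ Real.exp (lam * β) * F.real (Ioi α) := by
  have hind : Integrable ((Ioi α).indicator fun _ : ℝ => (1 : ℝ)) F :=
    (integrable_const 1).indicator measurableSet_Ioi
  have hpt : ∀ x : ℝ, Real.exp (lam * x) ≤
      Real.exp (-(t * β)) * Real.exp ((lam + t) * x)
        + Real.exp (u * α) * Real.exp ((lam - u) * x)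
        + Real.exp (lam * β) * (Ioi α).indicator (fun _ : ℝ => (1 : ℝ)) x := by
    intro x
    rw [← Real.exp_add, ← Real.exp_add]
    have p1 := Real.exp_pos (-(t * β) + (lam + t) * x)
    have p2 := Real.exp_pos (u * α + (lam - u) * x)
    have p3 : 0 ≤ Real.exp (lam * β) * (Ioi α).indicator (fun _ : ℝ => (1 : ℝ)) x :=
      mul_nonneg (Real.exp_pos _).le (indicator_nonneg (fun _ _ => zero_le_one) _)
    rcases le_or_gt x α with h | h
    · have : Real.exp (lam * x) ≤ Real.exp (u * α + (lam - u) * x) := by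
        apply Real.exp_le_exp.2
        nlinarith
      linarith
    rcases le_or_gt x β with h' | h'
    · have : Real.exp (lam * x) ≤ Real.exp (lam * β) :=
        Real.exp_le_exp.2 (mul_le_mul_of_nonneg_left h' hlam)
      rw [indicator_of_mem (mem_Ioi.2 h), mul_one]
      linarith
    · have : Real.exp (lam * x) ≤ Real.exp (-(t * β) + (lam + t) * x) := by
        apply Real.exp_le_exp.2
        nlinarith
      linarith
  have h12 : Integrable (fun x => Real.exp (-(t * β)) * Real.exp ((lam + t) * x)
      + Real.exp (u * α) * Real.exp ((lam - u) * x)) F :=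
    (hintt.const_mul _).add (hintu.const_mul _)
  have h3 := hind.const_mul (Real.exp (lam * β))
  have hI := integral_mono hint (h12.add h3) hpt
  rw [integral_add' h12 h3, integral_add (hintt.const_mul _) (hintu.const_mul _),
    integral_const_mul, integral_const_mul, integral_const_mul,
    integral_indicator_const _ measurableSet_Ioi, smul_eq_mul, mul_one] at hI
  simp only [mgf, id] at hβ hα ⊢
  linarith

theorem integrable_exp_mul_of_isLUB [IsFiniteMeasure F] {r : ℝ}
    (hr : IsLUB {s : ℝ | Integrable (fun x : ℝ => Real.exp (s * x)) F} r)
    {s : ℝ} (hs0 : 0 ≤ s) (hsr : s < r) : Integrable (fun x : ℝ => Real.exp (s * x)) F := by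
  obtain ⟨t, ht, hst, -⟩ := hr.exists_between hsr
  exact integrable_exp_mul_of_nonneg_of_le (X := id) ht hs0 hst.le

theorem continuousOn_mgf_Ioo [IsFiniteMeasure F] {r : ℝ}
    (hr : IsLUB {s : ℝ | Integrable (fun x : ℝ => Real.exp (s * x)) F} r) :
    ContinuousOn (mgf id F) (Ioo 0 r) := by
  refine (continuousOn_mgf (X := id) (μ := F)).mono ?_
  refine isOpen_Ioo.subset_interior_iff.2 fun s hs => ?_
  exact integrable_exp_mul_of_isLUB hr hs.1.le hs.2

/-- Monotonicity of the moment generating function up to the total mass, which accounts for the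
negative half-line. -/
theorem mgf_le_mgf_add_real_univ [IsFiniteMeasure F] {s t : ℝ} (hs : 0 ≤ s) (hst : s ≤ t)
    (ht : Integrable (fun x : ℝ => Real.exp (t * x)) F) :
    mgf id F s ≤ mgf id F t + F.real univ := by
  have hsi : Integrable (fun x : ℝ => Real.exp (s * x)) F :=
    integrable_exp_mul_of_nonneg_of_le (X := id) ht hs hst
  have h := integral_mono hsi (ht.add (integrable_const (1 : ℝ))) fun x => by
    change Real.exp (s * x) ≤ Real.exp (t * x) + 1
    rcases le_total 0 x with h | h
    · have := Real.exp_le_exp.2 (mul_le_mul_of_nonneg_right hst h)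
      linarith
    · have := Real.exp_le_one_iff.2 (mul_nonpos_of_nonneg_of_nonpos hs h)
      linarith [Real.exp_pos (t * x)]
  simp only [Pi.add_apply] at h
  rw [integral_add ht (integrable_const _)] at h
  simpa [mgf] using h

/-- Regular variation of negative index forces the moment generating function to blow up at the
critical exponent: the logarithm grows geometrically along `s₀ / 2 ^ n`, and near-monotonicity fills
the gaps. -/
theorem tendsto_mgf_atTop_of_ratio [IsFiniteMeasure F] {r ρ : ℝ} (hr0 : 0 < r) (hρ : 0 < ρ)
    (hr : IsLUB {s : ℝ | Integrable (fun x : ℝ => Real.exp (s * x)) F} r)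
    (hpos : ∀ᶠ s in 𝓝[>] 0, 0 < Real.log (mgf id F (r - s)))
    (hratio : Tendsto (fun s => Real.log (mgf id F (r - 2⁻¹ * s)) / Real.log (mgf id F (r - s)))
      (𝓝[>] 0) (𝓝 ((2⁻¹ : ℝ) ^ (-ρ)))) :
    Tendsto (fun s => mgf id F (r - s)) (𝓝[>] 0) atTop := by
  have h2 : (1 : ℝ) < 2⁻¹ ^ (-ρ) :=
    Real.one_lt_rpow_of_pos_of_lt_one_of_neg (by norm_num) (by norm_num) (neg_lt_zero.2 hρ)
  obtain ⟨c, hc1, hc2⟩ := exists_between h2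
  have hev := (hpos.and (hratio.eventually (lt_mem_nhds hc2))).and
    (Ioo_mem_nhdsGT hr0)
  obtain ⟨s₀, hs₀ : 0 < s₀, hs⟩ := mem_nhdsGT_iff_exists_Ioc_subset.1 hev
  have hgeo : ∀ n : ℕ, c ^ n * Real.log (mgf id F (r - s₀)) ≤
      Real.log (mgf id F (r - 2⁻¹ ^ n * s₀)) := by
    intro n
    induction n with
    | zero => simp
    | succ n ih =>
      have hp : (2⁻¹ : ℝ) ^ n ≤ 1 := pow_le_one₀ (by norm_num) (by norm_num)
      obtain ⟨⟨hK, hq⟩, -⟩ := hs ⟨by positivity, mul_le_of_le_one_left hs₀.le hp⟩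
      rw [lt_div_iff₀ hK] at hq
      have e : (2⁻¹ : ℝ) ^ (n + 1) * s₀ = 2⁻¹ * (2⁻¹ ^ n * s₀) := by ring
      rw [e, pow_succ']
      nlinarith
  have hK₀ := (hs ⟨hs₀, le_rfl⟩).1.1
  have htop : Tendsto (fun n : ℕ => c ^ n * Real.log (mgf id F (r - s₀))) atTop atTop :=
    (tendsto_pow_atTop_atTop_of_one_lt hc1).atTop_mul_const hK₀
  refine tendsto_atTop.2 fun B => ?_
  obtain ⟨n, hn⟩ := (htop.eventually (eventually_ge_atTop (B + F.real univ))).exists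
  -- For `s < s₀ / 2 ^ n`, `M (r - s) ≥ M (r - s₀ / 2 ^ n) - F ℝ ≥ B`.
  have hp : (2⁻¹ : ℝ) ^ n ≤ 1 := pow_le_one₀ (by norm_num) (by norm_num)
  have hsn : 0 < (2⁻¹ : ℝ) ^ n * s₀ := by positivity
  obtain ⟨-, -, hsr⟩ := hs ⟨hsn, mul_le_of_le_one_left hs₀.le hp⟩
  filter_upwards [Ioo_mem_nhdsGT hsn] with s hs'
  have h1 := mgf_le_mgf_add_real_univ (F := F) (s := r - 2⁻¹ ^ n * s₀) (t := r - s)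
    (by linarith) (by linarith [hs'.2])
    (integrable_exp_mul_of_isLUB hr (by linarith [hs'.2]) (by linarith [hs'.1]))
  have h3 := Real.log_le_self (mgf_nonneg (X := id) (μ := F) (t := r - 2⁻¹ ^ n * s₀))
  linarith [hgeo n]

/-! ### Tail asymptotics -/

/-- The Tauberian half of the criterion. With `K s = log M (r - s)`, the tilt at `r - s`
concentrates around `ρ * K s / s`, and the intermediate value theorem makes every large `x` such
a point, up to a factor near `1`. -/
theorem eventually_exp_le_tail [IsFiniteMeasure F] {r ρ : ℝ} {l : ℝ → ℝ} (hr0 : 0 < r)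
    (hr : IsLUB {s : ℝ | Integrable (fun x : ℝ => Real.exp (s * x)) F} r)
    (hρ : 0 < ρ) (hl : IsSlowlyVarying l)
    (hK : (fun s : ℝ => Real.log (mgf id F (r - s))) ~[𝓝[>] 0] fun s => s ^ (-ρ) * l (1 / s))
    {k : ℝ} (hk : 1 < k) :
    ∀ᶠ x in atTop, Real.exp (-(r * k * x)) ≤ F.real (Ioi x) := by
  set K : ℝ → ℝ := fun s => Real.log (mgf id F (r - s))
  have hpos := hl.eventually_pos hK
  have hMtop : Tendsto (fun s => mgf id F (r - s)) (𝓝[>] 0) atTop :=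
    tendsto_mgf_atTop_of_ratio hr0 hρ hr hpos (hl.tendsto_ratio hK (by norm_num))
  have hKtop : Tendsto K (𝓝[>] 0) atTop := Real.tendsto_log_atTop.comp hMtop
  -- `a < ρ < k * a`, so that the concentration window around `ρ * K s / s` is `[a, k * a] * K s / s`.
  obtain ⟨a, ha0, ha, hb⟩ : ∃ a, 0 < a ∧ a < ρ ∧ ρ < k * a := by
    refine ⟨2 * ρ / (1 + k), by positivity, ?_, ?_⟩
    · rw [div_lt_iff₀ (by positivity)]; nlinarith
    · rw [← mul_div_assoc, lt_div_iff₀ (by positivity)]; nlinarith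
  obtain ⟨δ, hδ0, hδ1, hδb, hδa⟩ := exists_rpow_neg_lt ha hb
  -- The margins left by `v` and `w`, multiplied by `K s → ∞`, absorb the factors `1 / 4`.
  obtain ⟨v, hv1, hv2⟩ := exists_between hδb
  obtain ⟨w, hw1, hw2⟩ := exists_between hδa
  have ev := (hl.tendsto_ratio hK (c := 1 - δ) (by linarith)).eventually (gt_mem_nhds hv1)
  have ew := (hl.tendsto_ratio hK (c := 1 + δ) (by linarith)).eventually (gt_mem_nhds hw1)
  have hev := (((ev.and ew).and (hpos.and (hMtop.eventually (eventually_ge_atTop 2)))).and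
    ((hKtop.eventually (eventually_ge_atTop (Real.log 4 / (1 + k * a * δ - v)))).and
      (hKtop.eventually (eventually_ge_atTop (Real.log 4 / (1 - a * δ - w)))))).and
    (Ioo_mem_nhdsGT (half_pos hr0))
  obtain ⟨s₁, hs₁ : 0 < s₁, hs⟩ := mem_nhdsGT_iff_exists_Ioc_subset.1 hev
  -- `s ↦ a * K s / s` is continuous and tends to infinity, so it takes the value `x`.
  have hcont : ContinuousOn (fun s => a * (K s * s⁻¹)) (Ioc 0 s₁) := by
    refine continuousOn_const.mul (ContinuousOn.mul ?_ ?_)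
    · refine ContinuousOn.log ?_ ?_
      · refine (continuousOn_mgf_Ioo hr).comp (by fun_prop) fun s h => ?_
        have := (hs h).2
        exact ⟨by linarith [this.2], by linarith [this.1]⟩
      · intro s h
        have := (hs h).1.1.2.2
        linarith
    · exact continuousOn_inv₀.mono fun s h => h.1.ne'
  have hytop : Tendsto (fun s => a * (K s * s⁻¹)) (𝓝[>] 0) atTop :=
    (hKtop.atTop_mul_atTop₀ tendsto_inv_nhdsGT_zero).const_mul_atTop ha0
  filter_upwards [eventually_ge_atTop (a * (K s₁ * s₁⁻¹)), eventually_gt_atTop 0] with x hx hx0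
  obtain ⟨s', hs'1, hs'2⟩ := ((hytop.eventually (eventually_ge_atTop x)).and
    (Ioo_mem_nhdsGT hs₁)).exists
  obtain ⟨s, hss, hsx⟩ := intermediate_value_Icc' hs'2.2.le
    (hcont.mono fun z hz => ⟨hs'2.1.trans_le hz.1, hz.2⟩) ⟨hx, hs'1⟩
  have hs0 : 0 < s := hs'2.1.trans_le hss.1
  obtain ⟨⟨⟨⟨h1, h2⟩, hKs, hM2⟩, h3, h4⟩, -, hsr⟩ := hs ⟨hs0, hss.2⟩
  have hM2 : 2 ≤ mgf id F (r - s) := hM2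
  have hsx : a * (K s * s⁻¹) = x := hsx
  have hsx' : s * x = a * K s := by rw [← hsx]; field_simp
  rw [div_lt_iff₀ hKs] at h1 h2
  rw [div_le_iff₀ (by linarith)] at h3 h4
  have hintg : ∀ z, 0 < z → z < r → Integrable (fun x : ℝ => Real.exp ((r - z) * x)) F :=
    fun z hz hzr => integrable_exp_mul_of_isLUB hr (by linarith) (by linarith)
  have hF : F ≠ 0 := by
    rintro rfl
    simp at hM2
    linarith
  have hexpK : ∀ z, 0 < z → z < r → mgf id F (r - z) = Real.exp (K z) := fun z hz hzr =>
    (Real.exp_log (mgf_pos' hF (hintg z hz hzr))).symm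
  have hM4 : mgf id F (r - s) / 4 = Real.exp (K s - Real.log 4) := by
    rw [hexpK s hs0 (by linarith), Real.exp_sub, Real.exp_log (by norm_num : (0 : ℝ) < 4)]
  have hδs : 0 < δ * s := by positivity
  have hδs' : δ * s < s := by nlinarith
  have et : r - s + δ * s = r - (1 - δ) * s := by ring
  have eu : r - s - δ * s = r - (1 + δ) * s := by ring
  have key := half_mgf_le_exp_mul_tail (F := F) (lam := r - s) (t := δ * s) (u := δ * s)
    (α := x) (β := k * x) (by linarith) hδs.le hδs.le (hintg s hs0 (by linarith))
    (by rw [et]; exact hintg _ (by linarith) (by linarith))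
    (by rw [eu]; exact hintg _ (by linarith) (by linarith))
    (by
      rw [hM4, et, hexpK _ (by linarith) (by linarith), ← Real.exp_add]
      apply Real.exp_le_exp.2
      have : δ * s * (k * x) = k * a * δ * K s := by linear_combination (δ * k) * hsx'
      nlinarith)
    (by
      rw [hM4, eu, hexpK _ (by linarith) (by linarith), ← Real.exp_add]
      apply Real.exp_le_exp.2
      have : δ * s * x = a * δ * K s := by linear_combination δ * hsx'
      nlinarith)
  have hle : Real.exp ((r - s) * (k * x)) ≤ Real.exp (r * k * x) := by
    apply Real.exp_le_exp.2
    have : 0 ≤ s * (k * x) := by positivity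
    nlinarith
  have h5 : 1 ≤ Real.exp (r * k * x) * F.real (Ioi x) :=
    (by linarith : (1 : ℝ) ≤ mgf id F (r - s) / 2).trans
      (key.trans (mul_le_mul_of_nonneg_right hle measureReal_nonneg))
  rw [Real.exp_neg, inv_le_iff_one_le_mul₀ (Real.exp_pos _), mul_comm]
  exact h5

/-- The tail asymptotics at the upper critical exponent, for any version of the tail lying between
`F (x, ∞)` and `F [x, ∞)`; this covers both ends of the line at once. -/
theorem log_tail_isEquivalent [IsFiniteMeasure F] {r ρ : ℝ} {l f : ℝ → ℝ} (hr0 : 0 < r)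
    (hr : IsLUB {s : ℝ | Integrable (fun x : ℝ => Real.exp (s * x)) F} r)
    (hρ : 0 < ρ) (hl : IsSlowlyVarying l)
    (hK : (fun s : ℝ => Real.log (mgf id F (r - s))) ~[𝓝[>] 0] fun s => s ^ (-ρ) * l (1 / s))
    (hf : ∀ x, F.real (Ioi x) ≤ f x) (hf' : ∀ x, f x ≤ F.real (Ici x)) :
    (fun x => Real.log (f x)) ~[atTop] fun x => -r * x := by
  refine (Asymptotics.isEquivalent_iff_tendsto_one ?_).2 ?_
  · filter_upwards [eventually_gt_atTop 0] with x hx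
    exact mul_ne_zero (neg_ne_zero.2 hr0.ne') hx.ne'
  refine tendsto_order.2 ⟨fun c hc => ?_, fun c hc => ?_⟩
  · -- Chernoff's bound at an exponent `lam` with `max c 0 * r < lam < r`.
    have hcr : max c 0 * r < r := by
      have : max c 0 < 1 := max_lt hc one_pos
      nlinarith
    obtain ⟨lam, hlam1, hlam2⟩ := exists_between hcr
    have hlam0 : 0 ≤ lam := (mul_nonneg (le_max_right _ _) hr0.le).trans hlam1.le
    have hcl : c * r < lam :=
      (mul_le_mul_of_nonneg_right (le_max_left c 0) hr0.le).trans_lt hlam1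
    have hint := integrable_exp_mul_of_isLUB hr hlam0 hlam2
    have hlin : Tendsto (fun x : ℝ => (lam - c * r) * x) atTop atTop :=
      tendsto_id.const_mul_atTop (sub_pos.2 hcl)
    filter_upwards [eventually_exp_le_tail hr0 hr hρ hl hK one_lt_two, eventually_gt_atTop 0,
      hlin.eventually (eventually_gt_atTop (Real.log (mgf id F lam)))] with x h1 hx h3
    have hfx : 0 < f x := (Real.exp_pos _).trans_le (h1.trans (hf x))
    have hch : f x ≤ Real.exp (-lam * x) * mgf id F lam :=
      (hf' x).trans (measure_ge_le_exp_mul_mgf (X := id) x hlam0 hint)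
    have hM : 0 < mgf id F lam := by
      by_contra h
      have := mul_nonpos_of_nonneg_of_nonpos (Real.exp_pos (-lam * x)).le (not_lt.1 h)
      linarith
    have hlog := Real.log_le_log hfx hch
    rw [Real.log_mul (Real.exp_pos _).ne' hM.ne', Real.log_exp] at hlog
    rw [Pi.div_apply, lt_div_iff_of_neg (by nlinarith)]
    nlinarith
  · obtain ⟨k, hk1, hkc⟩ := exists_between hc
    filter_upwards [eventually_exp_le_tail hr0 hr hρ hl hK hk1, eventually_gt_atTop 0]
      with x h1 hx
    have hlog := Real.log_le_log (Real.exp_pos _) (h1.trans (hf x))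
    rw [Real.log_exp] at hlog
    have hrx : 0 < r * x := mul_pos hr0 hx
    rw [Pi.div_apply, div_lt_iff_of_neg (by linarith)]
    nlinarith

end MGF

theorem mainTheorem2 (F : MeasureTheory.Measure ℝ) [MeasureTheory.IsFiniteMeasure F] (q r : ℝ)
    (hq : IsGLB {s : ℝ | MeasureTheory.Integrable (fun x : ℝ => Real.exp (s * x)) F} (-q))
    (hr : IsLUB {s : ℝ | MeasureTheory.Integrable (fun x : ℝ => Real.exp (s * x)) F} r)
    (hq0 : 0 < q) (hr0 : 0 < r) :
    (∀ (ρ : ℝ) (l : ℝ → ℝ), 0 < ρ → IsSlowlyVarying l →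
      (fun s : ℝ => Real.log (ProbabilityTheory.mgf id F (-q + s)))
        ~[𝓝[>] 0] (fun s : ℝ => s ^ (-ρ) * l (1 / s)) →
      (fun x : ℝ => Real.log (F.real (Set.Iic (-x))))
        ~[Filter.atTop] (fun x : ℝ => -q * x)) ∧
    (∀ (ρ : ℝ) (l : ℝ → ℝ), 0 < ρ → IsSlowlyVarying l →
      (fun s : ℝ => Real.log (ProbabilityTheory.mgf id F (r - s)))
        ~[𝓝[>] 0] (fun s : ℝ => s ^ (-ρ) * l (1 / s)) →
      (fun x : ℝ => Real.log (F.real (Set.Ioi x)))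
        ~[Filter.atTop] (fun x : ℝ => -r * x)) := by
  refine ⟨fun ρ l hρ hl hK => ?_, fun ρ l hρ hl hK => ?_⟩
  · -- Reflect `F` in the origin: its lower critical exponent becomes the upper one.
    have hint : ∀ s : ℝ, Integrable (fun x : ℝ => Real.exp (s * x)) (F.map Neg.neg) ↔
        Integrable (fun x : ℝ => Real.exp (-s * x)) F := fun s => by
      rw [integrable_map_measure (by fun_prop) (by fun_prop)]
      simp [Function.comp_def]
    have hmgf : ∀ s : ℝ, mgf id (F.map Neg.neg) s = mgf id F (-s) := fun s => by
      rw [mgf, mgf, integral_map (by fun_prop) (by fun_prop)]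
      simp
    have hrefl : ∀ x : ℝ, F.real (Set.Iic (-x)) = (F.map Neg.neg).real (Ici x) := fun x => by
      rw [map_measureReal_apply measurable_neg measurableSet_Ici]
      simp
    have hlub : IsLUB {s : ℝ | Integrable (fun x : ℝ => Real.exp (s * x)) (F.map Neg.neg)} q := by
      have := hq.neg
      rw [neg_neg] at this
      have hset : {s : ℝ | Integrable (fun x : ℝ => Real.exp (s * x)) (F.map Neg.neg)} =
          -{s : ℝ | Integrable (fun x : ℝ => Real.exp (s * x)) F} := Set.ext hint
      rwa [hset]
    refine log_tail_isEquivalent (F := F.map Neg.neg) hq0 hlub hρ hl ?_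
      (fun x => ?_) (fun x => (hrefl x).le)
    · simpa only [hmgf, neg_sub, sub_eq_neg_add, neg_add_rev, neg_neg] using hK
    · rw [hrefl]
      exact measureReal_mono Ioi_subset_Ici_self
  · exact log_tail_isEquivalent hr0 hr hρ hl hK (fun _ => le_rfl)
      (fun x => measureReal_mono Ioi_subset_Ici_self)
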